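/- A \emph{kernel} is a triple $(J,\mu,W)$ where $J$ is a standard Borel space, $\mu$ is a Borel probability measure on $J$ and $W\colon J^3\to\mathbf{R}$ is a bounded Borel-measurable function. For $n\ge 1$, let $\mathbf{H}(W,n)$ be the random function $[n]^3\to\mathbf{R}$, $(i,j,k)\mapsto W(x_i,x_j,x_k)$, where $(x_1,\dotsc,x_n)$ is $\mu^n$-random. For $H\colon[n]^3\to\mathbf{R}$ let $t(H,W)$ be the probability that $\mathbf{H}(W,n)=H$. The kernel is \emph{twin-free} if there are no two distinct points $x,x'\in J$ such that $W(x,y,z)=W(x',y,z)$ for $\mu^2$-almost every $(y,z)\in J^2$. Let $(J_1,\mu_1,W_1)$ and $(J_2,\mu_2,W_2)$ be two twin-free kernels. Assume that one of the following holds: (a) for every $n\ge1$, the random functions $\mathbf{H}(W_1,n)$ and $\mathbf{H}(W_2,n)$ have the same distribution; or (b) at least one of $W_1$, $W_2$ takes only countably many values, and $t(H,W_1)=t(H,W_2)$ for every $n\ge 1$ and every $H\colon[n]^3\to\mathbf{R}$. Then there exist measurable sets $N_1\subseteq J_1$ and $N_2\subseteq J_2$ with $\mu_1(N_1)=0=\mu_2(N_2)$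 and a bijection $\rho\colon J_1\setminus N_1\to J_2\setminus N_2$ such that $\rho$ and $\rho^{-1}$ are measure preserving and $W_1(x,y,z)=W_2(\rho(x),\rho(y),\rho(z))$ for $\mu_1^3$-almost every $(x,y,z)$. -/

import Mathlib

open MeasureTheory

/-- A three-variable kernel `(J, μ, W)`: a probability measure `μ` on `J` and a bounded measurable
function `W : J³ → ℝ`. -/
structure TriKernel (J : Type*) [MeasurableSpace J] where
  μ : Measure J
  isProb : IsProbabilityMeasure μ
  W : J × J × J → ℝ
  measurable_W : Measurable W
  bounded_W : ∃ C : ℝ, ∀ p, |W p| ≤ C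

attribute [instance] TriKernel.isProb

namespace TriKernel

/-- The set of all functions `H : [n]³ → ℝ`, with the product σ-algebra. -/
abbrev Pattern (n : ℕ) : Type := Fin n × Fin n × Fin n → ℝ

/-- The function `(i, j, k) ↦ W (x i, x j, x k)` induced by a tuple `x ∈ Jⁿ`. -/
def induced {J : Type*} [MeasurableSpace J] (K : TriKernel J) {n : ℕ} (x : Fin n → J) :
    Pattern n :=
  fun p => K.W (x p.1, x p.2.1, x p.2.2)

/-- The probability that the function induced by a `μⁿ`-random tuple belongs to `B`. -/
noncomputable def sampleProb {J : Type*} [MeasurableSpace J] (K : TriKernel J) {n : ℕ}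
    (B : Set (Pattern n)) : ENNReal :=
  Measure.pi (fun _ : Fin n => K.μ) {x | K.induced x ∈ B}

/-- The density `t(H, W)`: the probability that the function induced by a `μⁿ`-random tuple
is equal to `H`. -/
noncomputable def density {J : Type*} [MeasurableSpace J] {n : ℕ} (H : Pattern n)
    (K : TriKernel J) : ENNReal :=
  K.sampleProb {H}

/-- For every `n ≥ 1` and every `H : [n]³ → ℝ`, the densities of `H` in the two kernels agree. -/
def SameDensities {J₁ J₂ : Type*} [MeasurableSpace J₁] [MeasurableSpace J₂]
    (K₁ : TriKernel J₁) (K₂ : TriKernel J₂) : Prop :=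
  ∀ n : ℕ, 1 ≤ n → ∀ H : Pattern n, density H K₁ = density H K₂

/-- For every `n ≥ 1`, the random functions on `[n]³` sampled from the two kernels have the same
distribution. -/
def SameSampling {J₁ J₂ : Type*} [MeasurableSpace J₁] [MeasurableSpace J₂]
    (K₁ : TriKernel J₁) (K₂ : TriKernel J₂) : Prop :=
  ∀ n : ℕ, 1 ≤ n → ∀ B : Set (Pattern n), MeasurableSet B → K₁.sampleProb B = K₂.sampleProb B

/-- `x` and `x'` are twins if `W (x, y, z) = W (x', y, z)` for `μ²`-almost every `(y, z)`. -/
def Twins {J : Type*} [MeasurableSpace J] (K : TriKernel J) (x x' : J) : Prop :=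
  ∀ᵐ q ∂(K.μ.prod K.μ), K.W (x, q) = K.W (x', q)

/-- A kernel is twin-free if no two distinct points are twins. -/
def TwinFree {J : Type*} [MeasurableSpace J] (K : TriKernel J) : Prop :=
  ∀ x x' : J, K.Twins x x' → x = x'

/-- There are null sets `N₁`, `N₂` and a bijection `ρ : J₁ ∖ N₁ → J₂ ∖ N₂` such that `ρ` and `ρ⁻¹`
are measure preserving and `W₁ = W₂^ρ` holds `μ₁³`-almost everywhere. -/
def IsomorphicModNull {J₁ J₂ : Type*} [MeasurableSpace J₁] [MeasurableSpace J₂]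
    (K₁ : TriKernel J₁) (K₂ : TriKernel J₂) : Prop :=
  ∃ (N₁ : Set J₁) (N₂ : Set J₂), MeasurableSet N₁ ∧ MeasurableSet N₂ ∧
    K₁.μ N₁ = 0 ∧ K₂.μ N₂ = 0 ∧
    ∃ ρ : {x : J₁ // x ∉ N₁} ≃ {x : J₂ // x ∉ N₂},
      MeasurePreserving ρ (K₁.μ.comap Subtype.val) (K₂.μ.comap Subtype.val) ∧
      MeasurePreserving ρ.symm (K₂.μ.comap Subtype.val) (K₁.μ.comap Subtype.val) ∧
      ∀ᵐ p ∂(K₁.μ.prod (K₁.μ.prod K₁.μ)),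
        ∀ (hx : p.1 ∉ N₁) (hy : p.2.1 ∉ N₁) (hz : p.2.2 ∉ N₁),
          K₁.W p = K₂.W (ρ ⟨p.1, hx⟩, ρ ⟨p.2.1, hy⟩, ρ ⟨p.2.2, hz⟩)

end TriKernel

/-! ### Tools from probability and descriptive set theory -/

open Filter Topology ProbabilityTheory

/-! Fix a sequence `x` of i.i.d. random pairs and send each point `v` to its feature, the sequence
of values `W (v, x j)`. By the law of large numbers, averages along `x` recover the integrals of `W
(v, ·)` over a countable generating π-system. In a twin-free kernel, the feature therefore
determines almost every `v` (`TwinFree.ae_injOn_feature`).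

Now add i.i.d. triples and decorate each with the features of its points and its value of `W`. The
empirical frequencies determine the law of a decorated triple (`ae_tendsto_frequency`). The whole
array of decorations is a function of the values of `W` on an i.i.d. family of points, so its law is
the same for both kernels (`SameSampling.map_sampleArray_eq`). Hence some typical choices in the two
kernels give the very same array (`exists_eq_of_map_eq`), and so the same law of decorated triples.
The feature map of the first kernel followed by the inverse of that of the second is the
isomorphism.

If one kernel takes countably many values, the samples have a common countable support, and
densities determine their laws. -/

/-- A countably generated σ-algebra is generated by a countable π-system containing the whole
space. -/
lemma exists_countable_piSystem_generateFrom (α : Type*) [m : MeasurableSpace α]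
    [MeasurableSpace.CountablyGenerated α] :
    ∃ C : Set (Set α), C.Countable ∧ IsPiSystem C ∧ m = MeasurableSpace.generateFrom C ∧
      Set.univ ∈ C := by
  obtain ⟨b, hb, hm⟩ := MeasurableSpace.CountablyGenerated.isCountablyGenerated (α := α)
  have hA : IsSetAlgebra (generateSetAlgebra b) := isSetAlgebra_generateSetAlgebra
  refine ⟨generateSetAlgebra b, countable_generateSetAlgebra hb,
    fun s hs t ht _ => hA.inter_mem hs ht, ?_, hA.univ_mem⟩
  rw [generateFrom_generateSetAlgebra_eq, hm]

/-- The strong law of large numbers for a function of the coordinates of an i.i.d. sequence. -/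
lemma strong_law_ae_infinitePi {A : Type*} [MeasurableSpace A] (ν : Measure A)
    [IsProbabilityMeasure ν] {f : A → ℝ} (hf : Measurable f) (hint : Integrable f ν) :
    ∀ᵐ x ∂(Measure.infinitePi fun _ : ℕ => ν),
      Tendsto (fun n : ℕ => (∑ i ∈ Finset.range n, f (x i)) / n) atTop (𝓝 (∫ a, f a ∂ν)) := by
  have hmp : ∀ i : ℕ, MeasurePreserving (Function.eval i)
      (Measure.infinitePi fun _ : ℕ => ν) ν :=
    fun i => measurePreserving_eval_infinitePi (fun _ : ℕ => ν) i
  have h := strong_law_ae_real (μ := Measure.infinitePi fun _ : ℕ => ν)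
    (fun i x => f (x i)) ((hmp 0).integrable_comp_of_integrable hint)
    (fun i j hij => (iIndepFun_infinitePi (P := fun _ : ℕ => ν) (X := fun _ => f)
      fun _ => hf).indepFun hij)
    (fun i => ⟨(hf.comp (measurable_pi_apply i)).aemeasurable,
      (hf.comp (measurable_pi_apply 0)).aemeasurable, by
      have e (i : ℕ) : Measure.map (fun x : ℕ → A => f (x i)) (Measure.infinitePi fun _ => ν)
          = ν.map f := by
        conv_rhs => rw [← (hmp i).map_eq, Measure.map_map hf (hmp i).measurable]
        rfl
      rw [e, e]⟩)
  have e : ∫ x, f (x 0) ∂(Measure.infinitePi fun _ : ℕ => ν) = ∫ a, f a ∂ν := by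
    conv_rhs => rw [← (hmp 0).map_eq]
    rw [integral_map (hmp 0).measurable.aemeasurable hf.aestronglyMeasurable]
  simpa only [e] using h

/-- Integrable functions with the same integrals over a generating π-system that contains the
whole space agree almost everywhere. -/
lemma ae_eq_of_setIntegral_eq_on_piSystem {α : Type*} [m : MeasurableSpace α] {ν : Measure α}
    {C : Set (Set α)} (hC : IsPiSystem C) (hm : m = MeasurableSpace.generateFrom C)
    (huniv : Set.univ ∈ C) {f g : α → ℝ} (hf : Integrable f ν) (hg : Integrable g ν)
    (h : ∀ s ∈ C, ∫ a in s, f a ∂ν = ∫ a in s, g a ∂ν) : f =ᵐ[ν] g := by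
  refine Integrable.ae_eq_of_forall_setIntegral_eq f g hf hg fun s hs hfin => ?_
  clear hfin
  induction s, hs using MeasurableSpace.induction_on_inter hm hC with
  | empty => simp
  | basic t ht => exact h t ht
  | compl t ht ih =>
    have h3 := h _ huniv
    simp only [Measure.restrict_univ] at h3
    linarith [integral_add_compl ht hf, integral_add_compl ht hg]
  | iUnion t hd ht ih =>
    rw [integral_iUnion ht hd hf.integrableOn, integral_iUnion ht hd hg.integrableOn]
    exact tsum_congr ih

/-- Almost sure events of two probability spaces are attained simultaneously along measurable maps
with the same law. -/
lemma exists_eq_of_map_eq {X Y Z : Type*} [MeasurableSpace X] [StandardBorelSpace X]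
    [MeasurableSpace Y] [StandardBorelSpace Y] [MeasurableSpace Z] [StandardBorelSpace Z]
    {P : Measure X} {Q : Measure Y} [IsProbabilityMeasure P]
    {T : X → Z} {S : Y → Z} (hT : Measurable T) (hS : Measurable S) (h : P.map T = Q.map S)
    {p : X → Prop} {q : Y → Prop} (hp : ∀ᵐ x ∂P, p x) (hq : ∀ᵐ y ∂Q, q y) :
    ∃ x y, p x ∧ q y ∧ T x = S y := by
  let := upgradeStandardBorel Z
  by_contra! hne
  set E := (toMeasurable P {x | ¬ p x})ᶜ
  set F := (toMeasurable Q {y | ¬ q y})ᶜ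
  have hE : MeasurableSet E := (measurableSet_toMeasurable _ _).compl
  have hF : MeasurableSet F := (measurableSet_toMeasurable _ _).compl
  have hE0 : P Eᶜ = 0 := by rw [compl_compl, measure_toMeasurable]; exact hp
  have hF0 : Q Fᶜ = 0 := by rw [compl_compl, measure_toMeasurable]; exact hq
  have hEp : ∀ x ∈ E, p x := fun x hx => by
    by_contra hn; exact hx (subset_toMeasurable _ _ hn)
  have hFq : ∀ x ∈ F, q x := fun x hx => by
    by_contra hn; exact hx (subset_toMeasurable _ _ hn)
  -- The images of the conull sets `E` and `F` are disjoint analytic sets, hence separated by a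
  -- Borel set `u`. The common law would then vanish on both `u` and `uᶜ`.
  obtain ⟨u, hu1, hu2, hu⟩ := (hE.analyticSet_image hT).measurablySeparable
    (hF.analyticSet_image hS) (by
      rw [Set.disjoint_left]
      rintro _ ⟨x, hx, rfl⟩ ⟨y, hy, hxy⟩
      exact hne x y (hEp x hx) (hFq y hy) hxy.symm)
  have h1 : P.map T uᶜ = 0 := by
    rw [Measure.map_apply hT hu.compl]
    exact measure_mono_null (fun x hx hxE => hx (hu1 ⟨x, hxE, rfl⟩)) hE0
  have h2 : P.map T u = 0 := by
    rw [h, Measure.map_apply hS hu]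
    exact measure_mono_null
      (fun y hy hyF => Set.disjoint_left.1 hu2 ⟨y, hyF, rfl⟩ hy) hF0
  have : IsProbabilityMeasure (P.map T) := Measure.isProbabilityMeasure_map hT.aemeasurable
  have := prob_add_prob_compl (μ := P.map T) hu
  simp [h1, h2] at this

/-- A measurable map between standard Borel spaces that is injective off a null set has a
measurable almost everywhere left inverse. -/
lemma exists_measurable_ae_leftInverse {X Y : Type*} [MeasurableSpace X] [StandardBorelSpace X]
    [Nonempty X] [MeasurableSpace Y] [StandardBorelSpace Y] {P : Measure X} {φ : X → Y}
    (hφ : Measurable φ) (hinj : ∃ N, MeasurableSet N ∧ P N = 0 ∧ Set.InjOn φ Nᶜ) :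
    ∃ r : Y → X, Measurable r ∧ ∀ᵐ x ∂P, r (φ x) = x := by
  obtain ⟨N, hN, hN0, hi⟩ := hinj
  have := hN.compl.standardBorel
  -- Lusin–Souslin: an injective measurable map on a standard Borel space is a measurable embedding.
  have he : MeasurableEmbedding (fun x : (Nᶜ : Set X) => φ x) :=
    Measurable.measurableEmbedding (by fun_prop) (hi.injective)
  obtain ⟨r, hr, hrφ⟩ := he.exists_measurable_extend measurable_subtype_coe fun _ => ‹Nonempty X›
  refine ⟨r, hr, ?_⟩
  have : ∀ᵐ x ∂P, x ∉ N := measure_eq_zero_iff_ae_notMem.1 hN0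
  filter_upwards [this] with x hx using congrFun hrφ ⟨x, hx⟩

/-! ### Features, decorated triples and laws of large numbers -/

namespace TriKernel

variable {J : Type*} [MeasurableSpace J]

lemma integrable_section (K : TriKernel J) (v : J) :
    Integrable (fun q => K.W (v, q)) (K.μ.prod K.μ) := by
  obtain ⟨C, hC⟩ := K.bounded_W
  exact Integrable.of_bound (C := C)
    (K.measurable_W.comp measurable_prodMk_left).aestronglyMeasurable (ae_of_all _ fun q => hC _)

/-- The values `W (v, x j)` seen from `v` along a sequence `x` of pairs. -/
def feature (K : TriKernel J) (x : ℕ → J × J) (v : J) : ℕ → ℝ := fun j => K.W (v, x j)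

lemma measurable_feature_uncurry (K : TriKernel J) :
    Measurable fun p : (ℕ → J × J) × J => K.feature p.1 p.2 := by
  have := K.measurable_W
  unfold feature
  fun_prop

lemma measurable_feature (K : TriKernel J) (x : ℕ → J × J) : Measurable (K.feature x) :=
  K.measurable_feature_uncurry.comp measurable_prodMk_left

/-- The feature maps of a twin-free kernel along almost every i.i.d. sequence of pairs are
injective off a null set. -/
lemma TwinFree.ae_injOn_feature [StandardBorelSpace J] {K : TriKernel J} (h : K.TwinFree) :
    ∀ᵐ x ∂(Measure.infinitePi fun _ : ℕ => K.μ.prod K.μ),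
      ∃ N, MeasurableSet N ∧ K.μ N = 0 ∧ Set.InjOn (K.feature x) Nᶜ := by
  obtain ⟨C, hCc, hCpi, hCm, hCu⟩ := exists_countable_piSystem_generateFrom (J × J)
  have hCs : ∀ s ∈ C, MeasurableSet s := fun s hs => by
    rw [hCm]; exact MeasurableSpace.measurableSet_generateFrom hs
  have hW := K.measurable_W
  have key : ∀ s ∈ C, ∀ᵐ x ∂(Measure.infinitePi fun _ : ℕ => K.μ.prod K.μ), ∀ᵐ v ∂K.μ,
      Tendsto (fun n : ℕ => (∑ i ∈ Finset.range n, s.indicator (fun q => K.W (v, q)) (x i)) / n)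
        atTop (𝓝 (∫ q in s, K.W (v, q) ∂(K.μ.prod K.μ))) := by
    intro s hs
    have hms := hCs s hs
    have hi : Measurable fun p : J × (J × J) => s.indicator (fun q => K.W (p.1, q)) p.2 := by
      have : (fun p : J × (J × J) => s.indicator (fun q => K.W (p.1, q)) p.2)
          = (Prod.snd ⁻¹' s).indicator K.W := by
        rfl
      rw [this]
      exact hW.indicator (measurable_snd hms)
    -- The strong law holds for each fixed `v` and almost every `x`. Joint measurability allows the
    -- two quantifiers to be exchanged.
    refine Measure.ae_ae_comm (p := fun (x : ℕ → J × J) (v : J) => Tendsto (fun n : ℕ =>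
      (∑ i ∈ Finset.range n, s.indicator (fun q => K.W (v, q)) (x i)) / n)
        atTop (𝓝 (∫ q in s, K.W (v, q) ∂(K.μ.prod K.μ)))) ?_ |>.2 (ae_of_all _ fun v => ?_)
    · refine measurableSet_tendsto_fun (fun n => ?_) ?_
      · refine Measurable.div_const (Finset.measurable_sum _ fun i _ => ?_) _
        exact hi.comp (f := fun p : (ℕ → J × J) × J => (p.2, p.1 i)) (by fun_prop)
      · have : Measurable fun v : J => ∫ q in s, K.W (v, q) ∂(K.μ.prod K.μ) :=
          (hW.stronglyMeasurable.integral_prod_right'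
            (ν := (K.μ.prod K.μ).restrict s)).measurable
        exact this.comp measurable_snd
    · have := strong_law_ae_infinitePi (K.μ.prod K.μ)
        (f := s.indicator (fun q => K.W (v, q))) (hi.comp measurable_prodMk_left)
        ((K.integrable_section v).indicator hms)
      simpa only [integral_indicator hms] using this
  filter_upwards [(ae_ball_iff hCc).2 key] with x hx
  have hx' := (ae_ball_iff hCc).2 hx
  refine ⟨toMeasurable K.μ {v | ¬ ∀ s (_ : s ∈ C), Tendsto (fun n : ℕ =>
      (∑ i ∈ Finset.range n, s.indicator (fun q => K.W (v, q)) (x i)) / n)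
        atTop (𝓝 (∫ q in s, K.W (v, q) ∂(K.μ.prod K.μ)))}, measurableSet_toMeasurable _ _,
      (measure_toMeasurable _).trans hx', fun v hv w hw hvw => h _ _ ?_⟩
  have hv' := not_not.1 fun hn => hv (subset_toMeasurable _ _ hn)
  have hw' := not_not.1 fun hn => hw (subset_toMeasurable _ _ hn)
  -- As `x` is fixed, the averages depend on `v` only through its feature. Equal features thus give
  -- equal integrals over every `s ∈ C`, which makes `v` and `w` twins.
  refine ae_eq_of_setIntegral_eq_on_piSystem hCpi hCm hCu (K.integrable_section v)
    (K.integrable_section w) fun s hs => tendsto_nhds_unique (hv' s hs) ?_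
  have hi (i : ℕ) : s.indicator (fun q => K.W (v, q)) (x i)
      = s.indicator (fun q => K.W (w, q)) (x i) := by
    by_cases hxs : x i ∈ s
    · simpa [hxs, feature] using congrFun hvw i
    · simp [hxs]
  simpa only [hi] using hw' s hs

/-- The values that `feature` and `W` take at a triple of points. -/
def decorated (K : TriKernel J) (x : ℕ → J × J) (u : J × J × J) :
    (ℕ → ℝ) × (ℕ → ℝ) × (ℕ → ℝ) × ℝ :=
  (K.feature x u.1, K.feature x u.2.1, K.feature x u.2.2, K.W u)

lemma measurable_decorated_uncurry (K : TriKernel J) :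
    Measurable fun p : (ℕ → J × J) × (J × J × J) => K.decorated p.1 p.2 := by
  have := K.measurable_W
  unfold decorated feature
  fun_prop

lemma measurable_decorated (K : TriKernel J) (x : ℕ → J × J) : Measurable (K.decorated x) :=
  K.measurable_decorated_uncurry.comp measurable_prodMk_left

/-- The law of i.i.d. pairs and independent i.i.d. triples. -/
noncomputable def sequenceLaw (K : TriKernel J) : Measure ((ℕ → J × J) × (ℕ → J × J × J)) :=
  (Measure.infinitePi fun _ : ℕ => K.μ.prod K.μ).prod
    (Measure.infinitePi fun _ : ℕ => K.μ.prod (K.μ.prod K.μ))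

instance (K : TriKernel J) : IsProbabilityMeasure K.sequenceLaw := by
  unfold sequenceLaw; infer_instance

/-- The empirical frequencies of the decorated triples converge almost surely. -/
lemma ae_tendsto_frequency (K : TriKernel J) {C : Set (Set ((ℕ → ℝ) × (ℕ → ℝ) × (ℕ → ℝ) × ℝ))}
    (hCc : C.Countable) (hCm : ∀ s ∈ C, MeasurableSet s) :
    ∀ᵐ p ∂K.sequenceLaw, ∀ s ∈ C,
      Tendsto (fun n : ℕ => (∑ l ∈ Finset.range n,
        s.indicator (fun _ => (1 : ℝ)) (K.decorated p.1 (p.2 l))) / n) atTop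
        (𝓝 (((K.μ.prod (K.μ.prod K.μ)).map (K.decorated p.1)).real s)) := by
  refine (ae_ball_iff hCc).2 fun s hs => ?_
  have hms := hCm s hs
  have hi : Measurable (s.indicator fun _ => (1 : ℝ)) := measurable_const.indicator hms
  -- Given the pairs `x`, the decorations of the triples are i.i.d., so the strong law applies for
  -- each fixed `x`.
  refine (Measure.ae_prod_iff_ae_ae ?_).2 (ae_of_all _ fun x => ?_)
  · refine measurableSet_tendsto_fun (fun n => ?_) ?_
    · refine Measurable.div_const (Finset.measurable_sum _ fun l _ => ?_) _
      exact hi.comp (K.measurable_decorated_uncurry.comp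
        (f := fun p : (ℕ → J × J) × (ℕ → J × J × J) => (p.1, p.2 l)) (by fun_prop))
    · have : Measurable fun x : ℕ → J × J =>
          (K.μ.prod (K.μ.prod K.μ)).real (Prod.mk x ⁻¹'
            ((fun p : (ℕ → J × J) × (J × J × J) => K.decorated p.1 p.2) ⁻¹' s)) :=
        (measurable_measure_prodMk_left (K.measurable_decorated_uncurry hms)).ennreal_toReal
      convert! this.comp measurable_fst using 1
      ext p
      simp only [Measure.real, Measure.map_apply (K.measurable_decorated p.1) hms]
      rfl
  · have := strong_law_ae_infinitePi (K.μ.prod (K.μ.prod K.μ))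
      (f := fun u => s.indicator (fun _ => (1 : ℝ)) (K.decorated x u))
      (hi.comp (K.measurable_decorated x))
      (Integrable.of_bound (C := 1) (hi.comp (K.measurable_decorated x)).aestronglyMeasurable
        (ae_of_all _ fun u => by by_cases hu : K.decorated x u ∈ s <;> simp [hu]))
    have e : ∫ u, s.indicator (fun _ => (1 : ℝ)) (K.decorated x u) ∂(K.μ.prod (K.μ.prod K.μ))
        = ((K.μ.prod (K.μ.prod K.μ)).map (K.decorated x)).real s := by
      rw [← integral_map (K.measurable_decorated x).aemeasurable hi.aestronglyMeasurable,
        integral_indicator hms]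
      simp
    rw [e] at this
    exact this

/-- The array of decorated triples along a pair of sequences. -/
def sampleArray (K : TriKernel J) (p : (ℕ → J × J) × (ℕ → J × J × J)) :
    ℕ → (ℕ → ℝ) × (ℕ → ℝ) × (ℕ → ℝ) × ℝ :=
  fun l => K.decorated p.1 (p.2 l)

lemma measurable_sampleArray (K : TriKernel J) : Measurable K.sampleArray :=
  measurable_pi_lambda _ fun l => K.measurable_decorated_uncurry.comp
    (f := fun p : (ℕ → J × J) × (ℕ → J × J × J) => (p.1, p.2 l)) (by fun_prop)

end TriKernel

/-! ### Equality of the laws of infinite samples -/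

namespace TriKernel

variable {J : Type*} [MeasurableSpace J]

lemma measurable_induced (K : TriKernel J) {n : ℕ} :
    Measurable fun x : Fin n → J => K.induced x := by
  have := K.measurable_W
  unfold induced
  fun_prop

/-- The array `W (z i, z j, z k)` of a family `z` of points with an arbitrary index set. -/
def array (K : TriKernel J) {ι : Type*} (z : ι → J) : ι × ι × ι → ℝ :=
  fun q => K.W (z q.1, z q.2.1, z q.2.2)

lemma measurable_array (K : TriKernel J) {ι : Type*} :
    Measurable fun z : ι → J => K.array z := by
  have := K.measurable_W
  unfold array
  fun_prop

lemma SameSampling.map_induced_eq {J₁ J₂ : Type*} [MeasurableSpace J₁] [MeasurableSpace J₂]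
    {K₁ : TriKernel J₁} {K₂ : TriKernel J₂} (h : K₁.SameSampling K₂) {n : ℕ} (hn : 1 ≤ n) :
    (Measure.pi fun _ : Fin n => K₁.μ).map K₁.induced
      = (Measure.pi fun _ : Fin n => K₂.μ).map K₂.induced := by
  ext B hB
  rw [Measure.map_apply K₁.measurable_induced hB, Measure.map_apply K₂.measurable_induced hB]
  exact h n hn B hB

/-- The entries indexed by `I` involve only points in the range of `e`. As `e` is injective, these
points form an i.i.d. `n`-tuple. -/
lemma map_array_restrict (K : TriKernel J) {ι : Type*} {n : ℕ} {e : Fin n → ι}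
    (he : Function.Injective e) (I : Finset (ι × ι × ι))
    (a : I → Fin n × Fin n × Fin n)
    (ha : ∀ q : I, (e (a q).1, e (a q).2.1, e (a q).2.2) = (q : ι × ι × ι)) :
    ((Measure.infinitePi fun _ : ι => K.μ).map K.array).map I.restrict =
      ((Measure.pi fun _ : Fin n => K.μ).map K.induced).map (fun H q => H (a q)) := by
  rw [Measure.map_map (Finset.measurable_restrict _) K.measurable_array,
    Measure.map_map (by fun_prop) K.measurable_induced, ← Measure.infinitePi_eq_pi,
    ← Measure.map_infinitePi_infinitePi_of_inj (P := fun _ : ι => K.μ) he,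
    Measure.map_map (Measurable.comp (by fun_prop) K.measurable_induced) (by fun_prop)]
  congr 1
  ext z q
  simp only [Function.comp_apply, Finset.restrict, array, induced, ← ha q]

/-- Kernels with the same finite samples have the same infinite samples. -/
lemma SameSampling.map_array_eq {J₁ J₂ : Type*} [MeasurableSpace J₁] [MeasurableSpace J₂]
    {K₁ : TriKernel J₁} {K₂ : TriKernel J₂} (h : K₁.SameSampling K₂) (ι : Type*) [Nonempty ι] :
    (Measure.infinitePi fun _ : ι => K₁.μ).map K₁.array
      = (Measure.infinitePi fun _ : ι => K₂.μ).map K₂.array := by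
  classical
  have := Measure.isProbabilityMeasure_map (μ := Measure.infinitePi fun _ : ι => K₂.μ)
    K₂.measurable_array.aemeasurable
  refine IsProjectiveLimit.unique (P := fun I =>
    ((Measure.infinitePi fun _ : ι => K₂.μ).map K₂.array).map I.restrict) (fun I => ?_)
    (fun I => rfl)
  obtain ⟨i₀⟩ := ‹Nonempty ι›
  -- Inserting `i₀` keeps `S` nonempty even when `I` is empty, since `SameSampling` only concerns `n
  -- ≥ 1`.
  let S : Finset ι := insert i₀
    (I.image Prod.fst ∪ I.image (fun q => q.2.1) ∪ I.image (fun q => q.2.2))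
  let e := S.equivFin
  have hmem (q : I) : (q : ι × ι × ι).1 ∈ S ∧ (q : ι × ι × ι).2.1 ∈ S ∧
      (q : ι × ι × ι).2.2 ∈ S := by
    have hq := q.2
    refine ⟨?_, ?_, ?_⟩ <;> simp only [S, Finset.mem_insert, Finset.mem_union]
    · exact .inr (.inl (.inl (Finset.mem_image_of_mem _ hq)))
    · exact .inr (.inl (.inr (Finset.mem_image_of_mem (fun q : ι × ι × ι => q.2.1) hq)))
    · exact .inr (.inr (Finset.mem_image_of_mem (fun q : ι × ι × ι => q.2.2) hq))
  have he : Function.Injective fun i => (e.symm i : ι) :=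
    Subtype.val_injective.comp e.symm.injective
  let a : I → Fin S.card × Fin S.card × Fin S.card := fun q =>
    (e ⟨_, (hmem q).1⟩, e ⟨_, (hmem q).2.1⟩, e ⟨_, (hmem q).2.2⟩)
  have hS : 1 ≤ S.card := Finset.card_pos.2 ⟨i₀, Finset.mem_insert_self _ _⟩
  rw [K₁.map_array_restrict he I a (by simp [a]), h.map_induced_eq hS,
    ← K₂.map_array_restrict he I a (by simp [a])]

lemma map_infinitePi_fin_three (μ : Measure J) [IsProbabilityMeasure μ] :
    (Measure.infinitePi fun _ : Fin 3 => μ).map (fun w => (w 0, w 1, w 2))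
      = μ.prod (μ.prod μ) := by
  have hi : iIndepFun (fun (i : Fin 3) (w : Fin 3 → J) => w i)
      (Measure.infinitePi fun _ : Fin 3 => μ) :=
    iIndepFun_infinitePi (P := fun _ : Fin 3 => μ) (X := fun _ v => v) fun _ => measurable_id
  have h := (hi.indepFun_prodMk (fun i => measurable_pi_apply i) 1 2 0
    (by decide) (by decide)).symm
  rw [h.map_prod_eq_prod_map_map (measurable_pi_apply 0).aemeasurable
      (Measurable.aemeasurable (by fun_prop)),
    Measure.infinitePi_map_eval_prod (P := fun _ : Fin 3 => μ) (by decide)]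
  congr 1
  exact Measure.infinitePi_map_eval (fun _ : Fin 3 => μ) 0

/-- Grouping the points of an i.i.d. family into pairs and triples. -/
def regroup (z : Bool × ℕ × Fin 3 → J) : (ℕ → J × J) × (ℕ → J × J × J) :=
  (fun j => (z (true, j, 0), z (true, j, 1)),
    fun l => (z (false, l, 0), z (false, l, 1), z (false, l, 2)))

lemma measurable_regroup : Measurable (regroup : (Bool × ℕ × Fin 3 → J) → _) := by
  unfold regroup
  fun_prop

/-- Currying splits the family into two independent halves, and each half into independent blocks of
three. The pairs discard the third point of each block. -/
lemma map_regroup (K : TriKernel J) :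
    (Measure.infinitePi fun _ : Bool × ℕ × Fin 3 => K.μ).map regroup = K.sequenceLaw := by
  have hblock {B : Type _} [MeasurableSpace B] {f : (Fin 3 → J) → B} (hf : Measurable f) :
      (Measure.infinitePi fun _ : ℕ × Fin 3 => K.μ).map (fun z j => f fun i => z (j, i))
        = Measure.infinitePi fun _ : ℕ => (Measure.infinitePi fun _ : Fin 3 => K.μ).map f := by
    rw [← Measure.infinitePi_map_pi (μ := fun _ : ℕ => Measure.infinitePi fun _ : Fin 3 => K.μ)
      (f := fun _ => f) (fun _ => hf),
      ← Measure.infinitePi_map_curry (μ := fun (_ : ℕ) (_ : Fin 3) => K.μ),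
      Measure.map_map (by fun_prop) (by fun_prop)]
    rfl
  have hsplit : (Measure.infinitePi fun _ : Bool × ℕ × Fin 3 => K.μ).map
      (fun z => (fun i : ℕ × Fin 3 => z (true, i), fun i : ℕ × Fin 3 => z (false, i)))
      = (Measure.infinitePi fun _ : ℕ × Fin 3 => K.μ).prod
        (Measure.infinitePi fun _ : ℕ × Fin 3 => K.μ) := by
    rw [← Measure.infinitePi_map_eval_prod
      (P := fun _ : Bool => Measure.infinitePi fun _ : ℕ × Fin 3 => K.μ)
      (i := true) (j := false) (by decide),
      ← Measure.infinitePi_map_curry (μ := fun (_ : Bool) (_ : ℕ × Fin 3) => K.μ),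
      Measure.map_map (by fun_prop) (by fun_prop)]
    rfl
  have h2 := hblock (f := fun w => (w 0, w 1)) (by fun_prop)
  have h3 := hblock (f := fun w => (w 0, w 1, w 2)) (by fun_prop)
  rw [Measure.infinitePi_map_eval_prod (P := fun _ : Fin 3 => K.μ) (by decide)] at h2
  rw [map_infinitePi_fin_three] at h3
  rw [sequenceLaw, ← h2, ← h3, Measure.map_prod_map _ _ (by fun_prop) (by fun_prop), ← hsplit,
    Measure.map_map (by fun_prop) (by fun_prop)]
  rfl

/-- Every entry of the sample array, features included, is a value of `W` at three points of one
i.i.d. family. The map `g` reads these entries off the array of all values. -/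
lemma SameSampling.map_sampleArray_eq {J₁ J₂ : Type*} [MeasurableSpace J₁] [MeasurableSpace J₂]
    {K₁ : TriKernel J₁} {K₂ : TriKernel J₂} (h : K₁.SameSampling K₂) :
    K₁.sequenceLaw.map K₁.sampleArray = K₂.sequenceLaw.map K₂.sampleArray := by
  let ι := Bool × ℕ × Fin 3
  let g : (ι × ι × ι → ℝ) → ℕ → (ℕ → ℝ) × (ℕ → ℝ) × (ℕ → ℝ) × ℝ := fun A l =>
    (fun j => A ((false, l, 0), (true, j, 0), (true, j, 1)),
     fun j => A ((false, l, 1), (true, j, 0), (true, j, 1)),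
     fun j => A ((false, l, 2), (true, j, 0), (true, j, 1)),
     A ((false, l, 0), (false, l, 1), (false, l, 2)))
  have hg : Measurable g := by fun_prop
  rw [← K₁.map_regroup, ← K₂.map_regroup,
    Measure.map_map K₁.measurable_sampleArray measurable_regroup,
    Measure.map_map K₂.measurable_sampleArray measurable_regroup]
  have := congrArg (Measure.map g) (h.map_array_eq ι)
  rw [Measure.map_map hg K₁.measurable_array, Measure.map_map hg K₂.measurable_array] at this
  exact this

end TriKernel

/-! ### From equal laws to an isomorphism modulo null sets -/

/-- A measure preserving map induces measure preserving maps between complements of null sets. -/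
lemma MeasureTheory.MeasurePreserving.comap_subtype_val {X Y : Type*} [MeasurableSpace X]
    [MeasurableSpace Y] {P : Measure X} {Q : Measure Y} {f : X → Y} (hf : MeasurePreserving f P Q)
    {N : Set X} {M : Set Y} (hN : MeasurableSet N) (hM : MeasurableSet M) (hN0 : P N = 0)
    {ρ : {x : X // x ∉ N} → {y : Y // y ∉ M}} (hρf : ∀ x, (ρ x : Y) = f x) :
    MeasurePreserving ρ (P.comap Subtype.val) (Q.comap Subtype.val) := by
  have hρ : Measurable ρ := by
    have : Measurable fun x => (ρ x : Y) := by
      simpa only [hρf, Function.comp_def] using hf.measurable.comp measurable_subtype_coe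
    exact this.subtype_mk
  have iN : MeasurableEmbedding (Subtype.val : {x : X // x ∉ N} → X) :=
    .subtype_coe (s := Nᶜ) hN.compl
  have iM : MeasurableEmbedding (Subtype.val : {y : Y // y ∉ M} → Y) :=
    .subtype_coe (s := Mᶜ) hM.compl
  refine ⟨hρ, ?_⟩
  ext s hs
  rw [Measure.map_apply hρ hs, iN.comap_apply, iM.comap_apply,
    ← hf.measure_preimage (iM.measurableSet_image.2 hs).nullMeasurableSet]
  refine measure_congr ?_
  filter_upwards [measure_eq_zero_iff_ae_notMem.1 hN0] with x hx
  refine propext ⟨?_, ?_⟩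
  · rintro ⟨x', hx', rfl⟩
    exact ⟨_, hx', hρf x'⟩
  · rintro ⟨y, hy, hyx⟩
    refine ⟨⟨x, hx⟩, ?_, rfl⟩
    rwa [Set.mem_preimage, show ρ ⟨x, hx⟩ = y from Subtype.ext ((hρf _).trans hyx.symm)]

namespace TriKernel

section Marginals

variable {J : Type*} [MeasurableSpace J]

/-- Through this marginal, equal laws of decorated triples give equal laws of features. -/
lemma map_fst_map_decorated (K : TriKernel J) (x : ℕ → J × J) :
    ((K.μ.prod (K.μ.prod K.μ)).map (K.decorated x)).map Prod.fst = K.μ.map (K.feature x) := by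
  rw [Measure.map_map measurable_fst (K.measurable_decorated x)]
  conv_rhs => rw [← (measurePreserving_fst (μ := K.μ) (ν := K.μ.prod K.μ)).map_eq,
    Measure.map_map (K.measurable_feature x) measurable_fst]
  rfl

lemma sampleProb_eq_tsum_density (K : TriKernel J) {n : ℕ} {A : Set (Pattern n)}
    (hA : A.Countable) : K.sampleProb A = ∑' H : A, density H.1 K := by
  have := hA.to_subtype
  have e (B : Set (Pattern n)) (hB : MeasurableSet B) :
      K.sampleProb B = (Measure.pi fun _ : Fin n => K.μ).map K.induced B :=
    (Measure.map_apply K.measurable_induced hB).symm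
  simp only [density, e _ hA.measurableSet, e _ (measurableSet_singleton _)]
  rw [← measure_iUnion (fun i j hij => by simpa [Subtype.ext_iff] using hij)
    fun _ => measurableSet_singleton _]
  simp

lemma sampleProb_inter_of_sampleProb_eq_one (K : TriKernel J) {n : ℕ} {B S : Set (Pattern n)}
    (hSm : MeasurableSet S) (hS : K.sampleProb S = 1) :
    K.sampleProb (B ∩ S) = K.sampleProb B := by
  have : ∀ᵐ x ∂(Measure.pi fun _ : Fin n => K.μ), K.induced x ∈ S :=
    (prob_compl_eq_zero_iff (K.measurable_induced hSm)).2 hS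
  refine measure_congr ?_
  filter_upwards [this] with x hx
  exact propext ⟨fun h => h.1, fun h => ⟨h, hx⟩⟩

end Marginals

section Isomorphism

variable {J₁ J₂ : Type*} [MeasurableSpace J₁] [MeasurableSpace J₂]
  {K₁ : TriKernel J₁} {K₂ : TriKernel J₂}

/-- Measurable maps that are almost everywhere inverse to each other and transport the kernels
give an isomorphism modulo null sets. -/
lemma isomorphicModNull_of_ae_inverse [StandardBorelSpace J₁] [StandardBorelSpace J₂]
    {f : J₁ → J₂} {g : J₂ → J₁} (hf : MeasurePreserving f K₁.μ K₂.μ)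
    (hg : MeasurePreserving g K₂.μ K₁.μ)
    (hgf : ∀ᵐ x ∂K₁.μ, g (f x) = x) (hfg : ∀ᵐ y ∂K₂.μ, f (g y) = y)
    (hW : ∀ᵐ p ∂(K₁.μ.prod (K₁.μ.prod K₁.μ)), K₁.W p = K₂.W (f p.1, f p.2.1, f p.2.2)) :
    K₁.IsomorphicModNull K₂ := by
  let N₁ : Set J₁ := {x | g (f x) = x}ᶜ
  let N₂ : Set J₂ := {y | f (g y) = y}ᶜ
  have hN₁ : MeasurableSet N₁ :=
    (measurableSet_eq_fun (hg.measurable.comp hf.measurable) measurable_id).compl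
  have hN₂ : MeasurableSet N₂ :=
    (measurableSet_eq_fun (hf.measurable.comp hg.measurable) measurable_id).compl
  have hN₁' (x : J₁) : x ∉ N₁ ↔ g (f x) = x := not_not
  have hN₂' (y : J₂) : y ∉ N₂ ↔ f (g y) = y := not_not
  have hN₁0 : K₁.μ N₁ = 0 := hgf
  have hN₂0 : K₂.μ N₂ = 0 := hfg
  let ρ : {x : J₁ // x ∉ N₁} ≃ {y : J₂ // y ∉ N₂} :=
    { toFun := fun x => ⟨f x, (hN₂' _).2 (congrArg f ((hN₁' _).1 x.2))⟩
      invFun := fun y => ⟨g y, (hN₁' _).2 (congrArg g ((hN₂' _).1 y.2))⟩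
      left_inv := fun x => Subtype.ext ((hN₁' _).1 x.2)
      right_inv := fun y => Subtype.ext ((hN₂' _).1 y.2) }
  refine ⟨N₁, N₂, hN₁, hN₂, hN₁0, hN₂0, ρ,
    hf.comap_subtype_val hN₁ hN₂ hN₁0 fun _ => rfl,
    hg.comap_subtype_val hN₂ hN₁ hN₂0 fun _ => rfl, ?_⟩
  filter_upwards [hW] with p hp _ _ _ using hp

/-- Kernels whose decorated triples along essentially injective feature maps have the same law are
isomorphic modulo null sets. -/
lemma isomorphicModNull_of_map_decorated_eq [StandardBorelSpace J₁] [StandardBorelSpace J₂]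
    {x : ℕ → J₁ × J₁} {y : ℕ → J₂ × J₂}
    (hx : ∃ N, MeasurableSet N ∧ K₁.μ N = 0 ∧ Set.InjOn (K₁.feature x) Nᶜ)
    (hy : ∃ N, MeasurableSet N ∧ K₂.μ N = 0 ∧ Set.InjOn (K₂.feature y) Nᶜ)
    (h : (K₁.μ.prod (K₁.μ.prod K₁.μ)).map (K₁.decorated x)
      = (K₂.μ.prod (K₂.μ.prod K₂.μ)).map (K₂.decorated y)) :
    K₁.IsomorphicModNull K₂ := by
  have : Nonempty J₁ := nonempty_of_isProbabilityMeasure K₁.μ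
  have : Nonempty J₂ := nonempty_of_isProbabilityMeasure K₂.μ
  have hφ := K₁.measurable_feature x
  have hψ := K₂.measurable_feature y
  obtain ⟨r₁, hr₁, hr₁φ⟩ := exists_measurable_ae_leftInverse hφ hx
  obtain ⟨r₂, hr₂, hr₂ψ⟩ := exists_measurable_ae_leftInverse hψ hy
  have hν : K₁.μ.map (K₁.feature x) = K₂.μ.map (K₂.feature y) := by
    rw [← K₁.map_fst_map_decorated, ← K₂.map_fst_map_decorated, h]
  -- A left inverse of a feature map is also a right inverse almost everywhere for the law of the
  -- features. Both kernels share that law, so the statement passes from one to the other.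
  have hr₂t : ∀ᵐ t ∂(K₂.μ.map (K₂.feature y)), K₂.feature y (r₂ t) = t := by
    refine (ae_map_iff hψ.aemeasurable
      (measurableSet_eq_fun (hψ.comp hr₂) measurable_id)).2 ?_
    filter_upwards [hr₂ψ] with v hv using congrArg _ hv
  have hr₁t : ∀ᵐ t ∂(K₁.μ.map (K₁.feature x)), K₁.feature x (r₁ t) = t := by
    refine (ae_map_iff hφ.aemeasurable
      (measurableSet_eq_fun (hφ.comp hr₁) measurable_id)).2 ?_
    filter_upwards [hr₁φ] with v hv using congrArg _ hv
  have hr₂t' := ae_of_ae_map hφ.aemeasurable (hν ▸ hr₂t)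
  have hr₁t' := ae_of_ae_map hψ.aemeasurable (hν ▸ hr₁t)
  refine isomorphicModNull_of_ae_inverse (f := fun v => r₂ (K₁.feature x v))
    (g := fun w => r₁ (K₂.feature y w)) ⟨hr₂.comp hφ, ?_⟩ ⟨hr₁.comp hψ, ?_⟩ ?_ ?_ ?_
  · rw [← Function.comp_def, ← Measure.map_map hr₂ hφ, hν, Measure.map_map hr₂ hψ,
      Measure.map_congr (f := r₂ ∘ _) (g := id) hr₂ψ, Measure.map_id]
  · rw [← Function.comp_def, ← Measure.map_map hr₁ hψ, ← hν, Measure.map_map hr₁ hφ,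
      Measure.map_congr (f := r₁ ∘ _) (g := id) hr₁φ, Measure.map_id]
  · filter_upwards [hr₁φ, hr₂t'] with v hv hv'
    rw [hv', hv]
  · filter_upwards [hr₂ψ, hr₁t'] with v hv hv'
    rw [hv', hv]
  · have hW := K₂.measurable_W
    have hms : MeasurableSet {d : (ℕ → ℝ) × (ℕ → ℝ) × (ℕ → ℝ) × ℝ |
        d.2.2.2 = K₂.W (r₂ d.1, r₂ d.2.1, r₂ d.2.2.1)} :=
      measurableSet_eq_fun (by fun_prop) (by fun_prop)
    -- In the second kernel the value of a triple is almost surely a fixed measurable function of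
    -- its three features. This is a property of the law of decorated triples, so it holds for the
    -- first kernel too.
    have hd : ∀ᵐ d ∂((K₂.μ.prod (K₂.μ.prod K₂.μ)).map (K₂.decorated y)),
        d.2.2.2 = K₂.W (r₂ d.1, r₂ d.2.1, r₂ d.2.2.1) := by
      rw [ae_map_iff (K₂.measurable_decorated y).aemeasurable hms]
      have h1 : ∀ᵐ p ∂(K₂.μ.prod (K₂.μ.prod K₂.μ)), r₂ (K₂.feature y p.1) = p.1 :=
        Measure.quasiMeasurePreserving_fst.ae hr₂ψ
      have h2 : ∀ᵐ p ∂(K₂.μ.prod (K₂.μ.prod K₂.μ)), r₂ (K₂.feature y p.2.1) = p.2.1 :=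
        Measure.quasiMeasurePreserving_snd.ae (Measure.quasiMeasurePreserving_fst.ae hr₂ψ)
      have h3 : ∀ᵐ p ∂(K₂.μ.prod (K₂.μ.prod K₂.μ)), r₂ (K₂.feature y p.2.2) = p.2.2 :=
        Measure.quasiMeasurePreserving_snd.ae (Measure.quasiMeasurePreserving_snd.ae hr₂ψ)
      filter_upwards [h1, h2, h3] with p h1 h2 h3
      simp only [decorated, h1, h2, h3]
    rw [← h] at hd
    exact ae_of_ae_map (K₁.measurable_decorated x).aemeasurable hd

/-- Twin-free kernels with the same samples are isomorphic modulo null sets. -/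
theorem SameSampling.isomorphicModNull [StandardBorelSpace J₁] [StandardBorelSpace J₂]
    (h : K₁.SameSampling K₂) (h₁ : K₁.TwinFree) (h₂ : K₂.TwinFree) :
    K₁.IsomorphicModNull K₂ := by
  obtain ⟨C, hCc, hCpi, hCm, hCu⟩ :=
    exists_countable_piSystem_generateFrom ((ℕ → ℝ) × (ℕ → ℝ) × (ℕ → ℝ) × ℝ)
  have hCs : ∀ s ∈ C, MeasurableSet s := fun s hs => by
    rw [hCm]; exact MeasurableSpace.measurableSet_generateFrom hs
  have : StandardBorelSpace ((ℕ → ℝ) × (ℕ → ℝ) × (ℕ → ℝ) × ℝ) := inferInstance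
  obtain ⟨⟨x, u⟩, ⟨y, w⟩, ⟨hx, hxi⟩, ⟨hy, hyi⟩, hxy⟩ :=
    exists_eq_of_map_eq K₁.measurable_sampleArray K₂.measurable_sampleArray h.map_sampleArray_eq
      ((K₁.ae_tendsto_frequency hCc hCs).and
        (Measure.quasiMeasurePreserving_fst.ae h₁.ae_injOn_feature))
      ((K₂.ae_tendsto_frequency hCc hCs).and
        (Measure.quasiMeasurePreserving_fst.ae h₂.ae_injOn_feature))
  refine isomorphicModNull_of_map_decorated_eq hxi hyi ?_
  have hp₁ := Measure.isProbabilityMeasure_map (μ := K₁.μ.prod (K₁.μ.prod K₁.μ))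
    (K₁.measurable_decorated x).aemeasurable
  have hp₂ := Measure.isProbabilityMeasure_map (μ := K₂.μ.prod (K₂.μ.prod K₂.μ))
    (K₂.measurable_decorated y).aemeasurable
  refine ext_of_generate_finite C hCm hCpi (fun s hs => ?_) (by simp)
  -- Equal arrays have equal empirical frequencies, hence equal limits on the generating π-system.
  have hl (l : ℕ) : K₁.decorated x (u l) = K₂.decorated y (w l) := congrFun hxy l
  have h1 := hx s hs
  simp only [hl] at h1
  exact (measureReal_eq_measureReal_iff).1 (tendsto_nhds_unique h1 (hy s hs))

end Isomorphism

/-! ### Densities of kernels with countably many values -/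

section Densities

variable {J₁ J₂ : Type*} [MeasurableSpace J₁] [MeasurableSpace J₂]
  {K₁ : TriKernel J₁} {K₂ : TriKernel J₂}

lemma SameDensities.symm (h : K₁.SameDensities K₂) : K₂.SameDensities K₁ :=
  fun n hn H => (h n hn H).symm

lemma SameSampling.symm (h : K₁.SameSampling K₂) : K₂.SameSampling K₁ :=
  fun n hn B hB => (h n hn B hB).symm

/-- If one of the kernels takes countably many values, then densities determine samples. -/
lemma SameDensities.sameSampling_of_countable_range (h : K₁.SameDensities K₂)
    (hc : (Set.range K₁.W).Countable) : K₁.SameSampling K₂ := by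
  intro n hn B hB
  -- `S` is countable and has probability 1 for `K₁`. Summing densities gives it probability 1 for
  -- `K₂` as well, so both laws live on `S`, whatever the range of `K₂.W`.
  let S : Set (Pattern n) := Set.univ.pi fun _ => Set.range K₁.W
  have hS : S.Countable := Set.countable_univ_pi fun _ => hc
  have heq {A : Set (Pattern n)} (hA : A.Countable) : K₁.sampleProb A = K₂.sampleProb A := by
    rw [K₁.sampleProb_eq_tsum_density hA, K₂.sampleProb_eq_tsum_density hA]
    exact tsum_congr fun H => h n hn H
  have h1 : K₁.sampleProb S = 1 := by
    have : {x : Fin n → J₁ | K₁.induced x ∈ S} = Set.univ :=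
      Set.eq_univ_of_forall fun x q _ => ⟨_, rfl⟩
    rw [sampleProb, this, measure_univ]
  rw [← K₁.sampleProb_inter_of_sampleProb_eq_one hS.measurableSet h1,
    ← K₂.sampleProb_inter_of_sampleProb_eq_one hS.measurableSet (heq hS ▸ h1),
    heq (hS.mono Set.inter_subset_right)]

end Densities

end TriKernel

theorem mainTheorem8 {J₁ J₂ : Type*}
    [MeasurableSpace J₁] [StandardBorelSpace J₁] [MeasurableSpace J₂] [StandardBorelSpace J₂]
    (K₁ : TriKernel J₁) (K₂ : TriKernel J₂) (h₁ : K₁.TwinFree) (h₂ : K₂.TwinFree) :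
    (K₁.SameSampling K₂ → K₁.IsomorphicModNull K₂) ∧
    ((Set.range K₁.W).Countable ∨ (Set.range K₂.W).Countable →
      K₁.SameDensities K₂ → K₁.IsomorphicModNull K₂) := by
  refine ⟨fun h => h.isomorphicModNull h₁ h₂, ?_⟩
  rintro (hc | hc) h
  · exact (h.sameSampling_of_countable_range hc).isomorphicModNull h₁ h₂
  · exact (h.symm.sameSampling_of_countable_range hc).symm.isomorphicModNull h₁ h₂
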